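/- Let $m$ be the Lebesgue measure on the unit circle $\mathbb T$, normalized by $m(\mathbb T)=1$. For a finite positive Borel measure $\rho$ on $\mathbb T$ put \[ e_n(\rho)=\min_{q_0,\dots,q_{n-1}\in\mathbb C}\Bigl(\int_{\mathbb T}|q_0+q_1t+\dots+q_{n-1}t^{n-1}+t^n|^2\,d\rho(t)\Bigr)^{1/2}. \] Let $H\colon\mathbb T\to[0,+\infty]$ be measurable with $\int_{\mathbb T}H\,dm=+\infty$, and let $\lambda_H(a)=m\{H>a\}$. Let $\varphi\colon[0,\tfrac12]\to(0,+\infty]$ be continuous and (strictly) decreasing with $\varphi(0)=+\infty$ and $\varphi(\tfrac12)\le\inf_{\mathbb T}H$. For $\tau\in[-\tfrac12,\tfrac12]$ let $\theta_\tau\in[0,\tfrac12]$ be the solution of $\varphi(\theta_\tau)=H(e^{2\pi i\tau})$. Suppose that $H$ is subordinated to $\varphi$, that is, for every $\tau\in[-\tfrac12,\tfrac12]$, \[ H(e^{2\pi i\theta})\le\varphi(\theta+\theta_\tau-\tau)\quad(\tau-\theta_\tau<\theta\le\tau),\qquad H(e^{2\pi i\theta})\le\varphi(\tau+\theta_\tau-\theta)\quad(\tau\le\theta<\tau+\theta_\tau).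 \] Suppose also that $\varphi$ is regular, that is, there are constants $c>0$ and $C<\infty$ such that at least one of the following two conditions holds: (Reg1) the function $\theta\mapsto\theta\varphi(\theta)$ is non-decreasing on $(0,\tfrac12]$, and $\varphi(\theta)\ge c\log\frac1\theta$ for $0<\theta\le\tfrac12$; (Reg2) $\varphi(\theta/2)\le C\varphi(\theta)$ and $\varphi(\theta)\ge c/\theta$ for $0<\theta\le\tfrac12$. Suppose finally that $\int_{\mathbb T}e^{H}\,d\rho<\infty$, and that there is a constant $c'>0$ with $\log\varphi(\theta)\ge c'\log\frac1\theta$ for all sufficiently small $\theta>0$. (a) If $\liminf_{a\to\infty}a\lambda_H(a)>0$, then $e_n(\rho)$ decays at least like a negative power of $n$: there is $p>0$ such that $e_n(\rho)=O(n^{-p})$ as $n\to\infty$. (b) If $\lim_{a\to\infty}a\lambda_H(a)=\infty$, then $e_n(\rho)$ decays faster than any negative power of $n$: for every $p>0$, $e_n(\rho)=o(n^{-p})$ as $n\to\infty$. -/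

import Mathlib

open Set Filter Topology MeasureTheory
open scoped ENNReal NNReal

noncomputable section

namespace SzegoMin

/-- The point `t = exp (2 π i θ)` of the unit circle in `ℂ`, for `θ ∈ ℝ/ℤ`. The circle `𝕋` is
identified throughout with `ℝ/ℤ` by this map. -/
def pt (θ : UnitAddCircle) : ℂ := (AddCircle.toCircle θ : ℂ)

/-- `e_n(ρ)`: the distance in `L²(ρ)` from `t ^ n` to the polynomials of degree at most `n - 1`,
i.e. the minimal `L²(ρ)`-norm of a monic polynomial of degree `n`. -/
def szegoError (ρ : Measure UnitAddCircle) (n : ℕ) : ℝ :=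
  ⨅ q : Fin n → ℂ, √(∫ θ, ‖(∑ j : Fin n, q j * pt θ ^ (j : ℕ)) + pt θ ^ n‖ ^ 2 ∂ρ)

/-- The distribution function `λ_H(a) = m {H > a}`, `m` being the Lebesgue measure on the circle,
normalized to have total mass one. -/
def distribution (H : UnitAddCircle → ℝ≥0∞) (a : ℝ) : ℝ≥0∞ :=
  AddCircle.haarAddCircle {t : UnitAddCircle | ENNReal.ofReal a < H t}

/-- `φ : [0, 1/2] → (0, ∞]` is continuous and (strictly) decreasing, with `φ 0 = ∞`.
Values of `φ` outside `[0, 1/2]` play no role. -/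
structure IsMajorant (φ : ℝ → ℝ≥0∞) : Prop where
  continuousOn : ContinuousOn φ (Icc 0 (1 / 2))
  strictAntiOn : StrictAntiOn φ (Icc 0 (1 / 2))
  pos : ∀ θ ∈ Icc (0 : ℝ) (1 / 2), 0 < φ θ
  map_zero : φ 0 = ∞

/-- `H` is subordinated to `φ`. In the last two fields `s` is the (unique) solution `θ_τ` of
`φ s = H (exp (2 π i τ))`; it exists by the first two fields. -/
structure Subordinated (H : UnitAddCircle → ℝ≥0∞) (φ : ℝ → ℝ≥0∞) : Prop where
  majorant : IsMajorant φ
  le_inf : φ (1 / 2) ≤ ⨅ t, H t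
  left : ∀ τ ∈ Icc (-(1 / 2) : ℝ) (1 / 2), ∀ s ∈ Icc (0 : ℝ) (1 / 2),
    φ s = H (τ : UnitAddCircle) →
      ∀ θ : ℝ, τ - s < θ → θ ≤ τ → H (θ : UnitAddCircle) ≤ φ (θ + s - τ)
  right : ∀ τ ∈ Icc (-(1 / 2) : ℝ) (1 / 2), ∀ s ∈ Icc (0 : ℝ) (1 / 2),
    φ s = H (τ : UnitAddCircle) →
      ∀ θ : ℝ, τ ≤ θ → θ < τ + s → H (θ : UnitAddCircle) ≤ φ (τ + s - θ)

/-- First regularity condition: `θ ↦ θ φ(θ)` does not decrease and `φ(θ) ≳ log (1/θ)`. -/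
def Reg1 (φ : ℝ → ℝ≥0∞) : Prop :=
  MonotoneOn (fun θ : ℝ => ENNReal.ofReal θ * φ θ) (Ioc 0 (1 / 2)) ∧
    ∃ c : ℝ, 0 < c ∧ ∀ θ ∈ Ioc (0 : ℝ) (1 / 2), ENNReal.ofReal (c * Real.log (1 / θ)) ≤ φ θ

/-- Second regularity condition: `φ(θ/2) ≲ φ(θ)` and `φ(θ) ≳ 1/θ`. -/
def Reg2 (φ : ℝ → ℝ≥0∞) : Prop :=
  (∃ C : ℝ≥0, ∀ θ ∈ Ioc (0 : ℝ) (1 / 2), φ (θ / 2) ≤ C * φ θ) ∧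
    ∃ c : ℝ, 0 < c ∧ ∀ θ ∈ Ioc (0 : ℝ) (1 / 2), ENNReal.ofReal (c * (1 / θ)) ≤ φ θ

/-- `φ` is regular if at least one of the two conditions holds. -/
def Regular (φ : ℝ → ℝ≥0∞) : Prop := Reg1 φ ∨ Reg2 φ

end SzegoMin

end

noncomputable section

namespace SzegoMin

open Polynomial
open scoped ComplexConjugate

/-! Reversing coefficients turns a polynomial `P` of degree at most `n` with `P(0) ≠ 0` into a monic
one of degree `n`, so `e_n(ρ)` is at most the `L²(ρ)` norm of `P / P(0)` (`szegoError_le`). One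
therefore wants `|P|² ≲ e^H` on the circle with `P(0)` large.

Let `h = min(H, A)`. Subordination and doubling of `φ` show that `h` changes by at most a factor `D`
at a scale that is a power of `1/A` (`Subordinated.trunc_le_mul`, `IsMajorant.exists_pow_le`). Hence
an analytic polynomial `q` whose real part is a Fejér mean of `h`, of degree a power of `A`,
satisfies `Re q ≤ D h + 1` on the circle and `q(0) = ∫ h dm`. A truncated exponential series of `q /
(2D)` is the required `P`, and for `n` above a fixed power of `A` the error is at most a constant
times `exp(-∫ h dm / (2D))` (`szegoError_le_exp`).

If `a λ_H(a) ≥ d` for large `a`, the layer-cake formula gives `∫ h dm ≥ d log A - O(1)`, hence a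
power of `n` with exponent proportional to `d` (`exists_exponent`). Both parts of the theorem
follow, the second because `d` is then arbitrary. -/

/-! ### Points and distances on the circle -/

lemma norm_pt (θ : UnitAddCircle) : ‖pt θ‖ = 1 := Circle.norm_coe _

lemma continuous_pt : Continuous pt :=
  continuous_subtype_val.comp AddCircle.continuous_toCircle

lemma pt_sub (s t : UnitAddCircle) : pt (s - t) = pt s * conj (pt t) := by
  simp only [pt, sub_eq_add_neg, AddCircle.toCircle_add, AddCircle.toCircle_neg, Circle.coe_mul,
    Circle.coe_inv_eq_conj]

lemma pt_mul_conj (θ : UnitAddCircle) : pt θ * conj (pt θ) = 1 := by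
  rw [Complex.mul_conj, Complex.normSq_eq_norm_sq, norm_pt]; simp

/-- Every point of the circle has a real representative whose absolute value is its norm. -/
lemma exists_abs_eq_norm (x : UnitAddCircle) :
    ∃ d : ℝ, |d| ≤ 1 / 2 ∧ (d : UnitAddCircle) = x ∧ ‖x‖ = |d| := by
  induction x using QuotientAddGroup.induction_on with
  | H z =>
    refine ⟨z - round z, abs_sub_round z, ?_, UnitAddCircle.norm_eq⟩
    have : ((round z : ℝ) : UnitAddCircle) = 0 := by
      rw [AddCircle.coe_eq_zero_iff]; exact ⟨round z, by simp⟩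
    rw [AddCircle.coe_sub, this, sub_zero]

/-- The distance between two points of the circle is at least four times the length of the arc. -/
lemma four_mul_norm_le (x : UnitAddCircle) : 4 * ‖x‖ ≤ ‖pt x - 1‖ := by
  obtain ⟨d, hd, rfl, h1⟩ := exists_abs_eq_norm x
  have h2 : pt (d : UnitAddCircle) = Complex.exp (Complex.I * (2 * Real.pi * d : ℝ)) := by
    rw [pt, AddCircle.toCircle_apply_mk, Circle.coe_exp]
    congr 1; push_cast; ring
  have h3 : ‖2 * Real.sin (2 * Real.pi * d / 2)‖ = 2 * |Real.sin (Real.pi * |d|)| := by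
    rw [norm_mul, Real.norm_eq_abs, Real.norm_eq_abs, abs_two]
    congr 1
    rcases abs_cases d with ⟨h, -⟩ | ⟨h, -⟩
    · rw [h]; congr 2; ring
    · rw [h, mul_neg, Real.sin_neg, abs_neg]; congr 2; ring
  rw [h1, h2, Complex.norm_exp_I_mul_ofReal_sub_one, h3]
  -- Jordan's inequality `sin x ≥ 2x/π` on `[0, π/2]`.
  have h4 := Real.mul_le_sin (x := Real.pi * |d|) (by positivity)
    (by nlinarith [Real.pi_pos])
  have h5 : 2 / Real.pi * (Real.pi * |d|) = 2 * |d| := by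
    field_simp
  linarith [le_abs_self (Real.sin (Real.pi * |d|))]

/-! ### Reversed polynomials -/

lemma szegoError_le (ρ : Measure UnitAddCircle) (p : ℂ[X]) (h0 : p.coeff 0 ≠ 0) {n : ℕ}
    (hn : p.natDegree ≤ n) :
    szegoError ρ n ≤ √(∫ θ, ‖p.eval (pt θ)‖ ^ 2 ∂ρ) / ‖p.coeff 0‖ := by
  have hbdd : BddBelow (range fun q : Fin n → ℂ =>
      √(∫ θ, ‖(∑ j : Fin n, q j * pt θ ^ (j : ℕ)) + pt θ ^ n‖ ^ 2 ∂ρ)) :=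
    ⟨0, by rintro _ ⟨q, rfl⟩; positivity⟩
  -- On the circle `t^n · conj (p(t) / p(0))` is a monic polynomial of degree `n` with the modulus
  -- of `p / p(0)`; these are its lower coefficients.
  refine (ciInf_le hbdd fun j => conj (p.coeff (n - j) / p.coeff 0)).trans_eq ?_
  have key (θ : UnitAddCircle) :
      ‖(∑ j : Fin n, conj (p.coeff (n - j) / p.coeff 0) * pt θ ^ (j : ℕ)) + pt θ ^ n‖ ^ 2 =
        ‖p.eval (pt θ)‖ ^ 2 / ‖p.coeff 0‖ ^ 2 := by
    have e1 : (∑ j : Fin n, conj (p.coeff (n - j) / p.coeff 0) * pt θ ^ (j : ℕ)) + pt θ ^ n =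
        pt θ ^ n * conj (p.eval (pt θ) / p.coeff 0) := by
      rw [Fin.sum_univ_eq_sum_range
        (fun j => conj (p.coeff (n - j) / p.coeff 0) * pt θ ^ j) n]
      have e2 : pt θ ^ n = conj (p.coeff (n - n) / p.coeff 0) * pt θ ^ n := by
        rw [Nat.sub_self, div_self h0, map_one, one_mul]
      nth_rewrite 1 [e2]
      rw [← Finset.sum_range_succ (fun j => conj (p.coeff (n - j) / p.coeff 0) * pt θ ^ j) n,
        Polynomial.eval_eq_sum_range' (Nat.lt_succ_of_le hn), Finset.sum_div, map_sum,
        Finset.mul_sum, ← Finset.sum_range_reflect]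
      refine Finset.sum_congr rfl fun j hj => ?_
      have hj' : j ≤ n := Nat.lt_succ_iff.1 (Finset.mem_range.1 hj)
      have e3 : n + 1 - 1 - j = n - j := by omega
      have e4 : n - (n - j) = j := by omega
      have e5 : pt θ ^ n = pt θ ^ (n - j) * pt θ ^ j := by rw [← pow_add]; congr 1; omega
      have e6 : pt θ ^ j * conj (pt θ) ^ j = 1 := by rw [← mul_pow, pt_mul_conj, one_pow]
      rw [e3, e4, e5]
      simp only [map_div₀, map_mul, map_pow]
      linear_combination (-(pt θ ^ (n - j) * conj (p.coeff j) / conj (p.coeff 0))) * e6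
    rw [e1, norm_mul, norm_pow, norm_pt, one_pow, one_mul, RCLike.norm_conj, norm_div, div_pow]
  simp only [key]
  rw [integral_div, Real.sqrt_div' _ (by positivity), Real.sqrt_sq (norm_nonneg _)]

/-! ### Fejér kernel and Fejér means -/

/-- The analytic polynomial whose real part on the circle is the Fejér kernel. -/
def fejer (N : ℕ) (z : ℂ) : ℂ :=
  (1 / N : ℂ) * ∑ i ∈ Finset.range N, ∑ j ∈ Finset.range N, z ^ (i.dist j)

/-- Replacing the exponent `i - j` by `|i - j|` at most conjugates the power, which leaves its real
part alone. -/
lemma re_pow_dist {z : ℂ} (hz : ‖z‖ = 1) (i j : ℕ) :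
    (z ^ (i.dist j)).re = (z ^ i * conj (z ^ j)).re := by
  have h1 (k : ℕ) : z ^ k * conj (z ^ k) = 1 := by
    rw [Complex.mul_conj, Complex.normSq_eq_norm_sq, norm_pow, hz]; simp
  rcases le_total j i with h | h
  · have e : z ^ i = z ^ (i - j) * z ^ j := by rw [← pow_add]; congr 1; omega
    rw [Nat.dist_eq_sub_of_le_right h, e, mul_assoc, h1, mul_one]
  · have e : z ^ j = z ^ (j - i) * z ^ i := by rw [← pow_add]; congr 1; omega
    rw [Nat.dist_eq_sub_of_le h, e, map_mul, mul_left_comm, h1, mul_one, Complex.conj_re]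

lemma re_fejer (N : ℕ) {z : ℂ} (hz : ‖z‖ = 1) :
    (fejer N z).re = ‖∑ i ∈ Finset.range N, z ^ i‖ ^ 2 / N := by
  have h1 : ‖∑ i ∈ Finset.range N, z ^ i‖ ^ 2 =
      ((∑ i ∈ Finset.range N, z ^ i) * conj (∑ i ∈ Finset.range N, z ^ i)).re := by
    rw [Complex.mul_conj, Complex.normSq_eq_norm_sq, Complex.ofReal_re]
  have h2 : (1 / N : ℂ) = ((1 / N : ℝ) : ℂ) := by push_cast; rfl
  rw [fejer, h2, Complex.re_ofReal_mul, h1, map_sum, Finset.sum_mul_sum, Complex.re_sum,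
    Complex.re_sum, one_div, inv_mul_eq_div]
  congr 1
  refine Finset.sum_congr rfl fun i _ => ?_
  rw [Complex.re_sum, Complex.re_sum]
  exact Finset.sum_congr rfl fun j _ => re_pow_dist hz i j

lemma re_fejer_nonneg (N : ℕ) {z : ℂ} (hz : ‖z‖ = 1) : 0 ≤ (fejer N z).re := by
  rw [re_fejer N hz]; positivity

/-- The geometric sum times `z - 1` is `z^N - 1`, of modulus at most `2`. -/
lemma re_fejer_le (N : ℕ) {z : ℂ} (hz : ‖z‖ = 1) {d : ℝ} (hd : 0 < d) (h : d ≤ ‖z - 1‖) :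
    (fejer N z).re ≤ 4 / d ^ 2 / N := by
  rw [re_fejer N hz]
  gcongr
  have h1 : ‖∑ i ∈ Finset.range N, z ^ i‖ * ‖z - 1‖ ≤ 2 := by
    rw [← norm_mul, geom_sum_mul]
    refine (norm_sub_le _ _).trans ?_
    rw [norm_pow, hz]; norm_num
  have h2 : ‖∑ i ∈ Finset.range N, z ^ i‖ * d ≤ 2 :=
    (mul_le_mul_of_nonneg_left h (norm_nonneg _)).trans h1
  rw [le_div_iff₀ (by positivity), ← mul_pow]
  calc _ ≤ (2 : ℝ) ^ 2 := by gcongr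
    _ = 4 := by norm_num

lemma norm_fejer_le (N : ℕ) {z : ℂ} (hz : ‖z‖ ≤ 1) : ‖fejer N z‖ ≤ N := by
  have h : ‖∑ i ∈ Finset.range N, ∑ j ∈ Finset.range N, z ^ (i.dist j)‖ ≤ N * N := by
    refine (norm_sum_le_of_le (Finset.range N) (n := fun _ => (N : ℝ)) fun i _ => ?_).trans ?_
    · refine (norm_sum_le_of_le (Finset.range N) (n := fun _ => (1 : ℝ)) fun j _ => ?_).trans ?_
      · rw [norm_pow]; exact pow_le_one₀ (norm_nonneg _) hz
      · simp
    · simp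
  rw [fejer, norm_mul]
  rcases Nat.eq_zero_or_pos N with rfl | hN
  · simp
  · have hN' : (0 : ℝ) < N := by exact_mod_cast hN
    calc _ ≤ ‖(1 / N : ℂ)‖ * (N * N) := by gcongr
      _ = N := by simp; field_simp

lemma continuous_fejer (N : ℕ) : Continuous (fejer N) := by
  unfold fejer; fun_prop

lemma fejer_zero {N : ℕ} (hN : N ≠ 0) : fejer N 0 = 1 := by
  have h (i : ℕ) (hi : i ∈ Finset.range N) :
      ∑ j ∈ Finset.range N, (0 : ℂ) ^ (i.dist j) = 1 := by
    rw [Finset.sum_eq_single_of_mem i hi fun j _ hj => ?_]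
    · simp
    · exact zero_pow fun h => hj (Nat.eq_of_dist_eq_zero h).symm
  rw [fejer, Finset.sum_congr rfl h]
  simp [hN]

/-- Orthogonality of characters. The form `0 ^ k` makes the circle mean of a polynomial visibly its
value at the origin. -/
lemma integral_pt_pow (k : ℕ) :
    ∫ s, pt s ^ k ∂AddCircle.haarAddCircle = (0 : ℂ) ^ k := by
  have h := congrFun (fourierCoeff_fourier (T := 1) (k : ℤ)) 0
  have h2 (s : UnitAddCircle) : fourier (k : ℤ) s = pt s ^ k := by
    rw [fourier_apply, natCast_zsmul, AddCircle.toCircle_nsmul, Circle.coe_pow, pt]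
  simp only [fourierCoeff, neg_zero, fourier_zero, one_smul, h2] at h
  rw [h]
  rcases Nat.eq_zero_or_pos k with rfl | hk
  · simp
  · rw [zero_pow hk.ne', Pi.single_eq_of_ne]
    exact_mod_cast hk.ne

lemma integrable_of_continuous {f : UnitAddCircle → ℂ} (hf : Continuous f) :
    Integrable f AddCircle.haarAddCircle :=
  hf.integrable_of_hasCompactSupport (HasCompactSupport.of_compactSpace f)

lemma integral_fejer {N : ℕ} (hN : N ≠ 0) :
    ∫ s, fejer N (pt s) ∂AddCircle.haarAddCircle = 1 := by
  rw [← fejer_zero hN]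
  simp only [fejer]
  rw [integral_const_mul,
    integral_finsetSum _ (f := fun (i : ℕ) (s : UnitAddCircle) => ∑ j ∈ Finset.range N, pt s ^ (i.dist j))
    fun i _ => integrable_of_continuous (continuous_finsetSum _ fun j _ => continuous_pt.pow _)]
  congr 1
  refine Finset.sum_congr rfl fun i _ => ?_
  rw [integral_finsetSum _ (f := fun (j : ℕ) (s : UnitAddCircle) => pt s ^ (i.dist j))
    fun j _ => integrable_of_continuous (continuous_pt.pow _)]
  exact Finset.sum_congr rfl fun j _ => integral_pt_pow _

/-- The polynomial whose real part on the circle is the Fejér mean of `h`. -/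
def fejerMean (N : ℕ) (h : UnitAddCircle → ℝ) : ℂ[X] :=
  ∑ i ∈ Finset.range N, ∑ j ∈ Finset.range N,
    C ((1 / N : ℂ) * ∫ s, conj (pt s) ^ (i.dist j) * h s ∂AddCircle.haarAddCircle) *
      X ^ (i.dist j)

lemma natDegree_fejerMean_le (N : ℕ) (h : UnitAddCircle → ℝ) :
    (fejerMean N h).natDegree ≤ N := by
  refine natDegree_sum_le_of_forall_le _ _ fun i hi => natDegree_sum_le_of_forall_le _ _
    fun j hj => (natDegree_C_mul_X_pow_le _ _).trans ?_
  rw [Finset.mem_range] at hi hj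
  unfold Nat.dist; omega

lemma integrable_mul_bounded {f : UnitAddCircle → ℂ} (hf : Continuous f) {h : UnitAddCircle → ℝ}
    (hi : Integrable h AddCircle.haarAddCircle) :
    Integrable (fun s => f s * h s) AddCircle.haarAddCircle := by
  obtain ⟨B, hB⟩ := isCompact_univ.exists_bound_of_continuousOn hf.continuousOn
  exact hi.ofReal.bdd_mul hf.aestronglyMeasurable (Eventually.of_forall fun s => hB s (mem_univ s))

lemma eval_fejerMean (N : ℕ) {h : UnitAddCircle → ℝ}
    (hi : Integrable h AddCircle.haarAddCircle) (z : ℂ) :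
    (fejerMean N h).eval z =
      ∫ s, fejer N (z * conj (pt s)) * h s ∂AddCircle.haarAddCircle := by
  have hc (k : ℕ) : Continuous fun s : UnitAddCircle => (z * conj (pt s)) ^ k :=
    (continuous_const.mul (Complex.continuous_conj.comp continuous_pt)).pow k
  have e (s : UnitAddCircle) : fejer N (z * conj (pt s)) * h s =
      (1 / N : ℂ) * ∑ i ∈ Finset.range N, ∑ j ∈ Finset.range N,
        (z * conj (pt s)) ^ (i.dist j) * h s := by
    simp only [fejer, mul_assoc, Finset.sum_mul]
  simp only [e]
  rw [integral_const_mul, integral_finsetSum _ fun i _ => integrable_finsetSum _ fun j _ =>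
    integrable_mul_bounded (hc _) hi, fejerMean, eval_finsetSum, Finset.mul_sum]
  refine Finset.sum_congr rfl fun i _ => ?_
  rw [integral_finsetSum _ fun j _ => integrable_mul_bounded (hc _) hi, eval_finsetSum,
    Finset.mul_sum]
  refine Finset.sum_congr rfl fun j _ => ?_
  simp only [mul_pow, mul_assoc, integral_const_mul, eval_mul, eval_C, eval_pow, eval_X]
  ring

lemma eval_zero_fejerMean {N : ℕ} (hN : N ≠ 0) {h : UnitAddCircle → ℝ}
    (hi : Integrable h AddCircle.haarAddCircle) :
    (fejerMean N h).eval 0 = ((∫ s, h s ∂AddCircle.haarAddCircle : ℝ) : ℂ) := by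
  rw [eval_fejerMean N hi]
  simp only [zero_mul, fejer_zero hN, one_mul]
  exact integral_ofReal

/-- A crude bound on the closed disc, needed only to decide how many terms of the exponential series
to keep. -/
lemma norm_eval_fejerMean_le (N : ℕ) {h : UnitAddCircle → ℝ}
    (hi : Integrable h AddCircle.haarAddCircle) {M : ℝ} (hM : ∀ s, |h s| ≤ M) {z : ℂ}
    (hz : ‖z‖ ≤ 1) :
    ‖(fejerMean N h).eval z‖ ≤ N * M := by
  rw [eval_fejerMean N hi]
  refine (norm_integral_le_of_norm_le_const (C := N * M) (Eventually.of_forall fun s => ?_)).trans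
    (by simp)
  rw [norm_mul, Complex.norm_real, Real.norm_eq_abs]
  have : ‖z * conj (pt s)‖ ≤ 1 := by rwa [norm_mul, RCLike.norm_conj, norm_pt, mul_one]
  exact mul_le_mul (norm_fejer_le N this) (hM s) (abs_nonneg _) (Nat.cast_nonneg _)

/-- If `h` is almost constant at scale `η` near `x`, its Fejér mean at `x` is controlled by
`h x`. -/
lemma re_eval_fejerMean_le {N : ℕ} (hN : N ≠ 0) {h : UnitAddCircle → ℝ}
    (hi : Integrable h AddCircle.haarAddCircle) {M : ℝ} (h0 : ∀ s, 0 ≤ h s) (hM : ∀ s, h s ≤ M)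
    (x : UnitAddCircle) {η B : ℝ} (hη : 0 < η) (hB : 0 ≤ B)
    (hx : ∀ y, ‖x - y‖ ≤ η → h y ≤ B) :
    ((fejerMean N h).eval (pt x)).re ≤ B + 4 / (4 * η) ^ 2 / N * M := by
  have hc : Continuous fun s : UnitAddCircle => fejer N (pt (x - s)) :=
    (continuous_fejer N).comp (continuous_pt.comp (by fun_prop))
  have hint : Integrable (fun s => (fejer N (pt (x - s)) * h s).re) AddCircle.haarAddCircle :=
    (integrable_mul_bounded hc hi).re
  have h1 : ∫ s, (fejer N (pt (x - s))).re ∂AddCircle.haarAddCircle = 1 := by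
    have := integral_re (integrable_of_continuous hc)
    simp only [RCLike.re_eq_complex_re] at this
    rw [this, integral_sub_left_eq_self (fun s => fejer N (pt s)), integral_fejer hN]
    simp
  have h2 : ((fejerMean N h).eval (pt x)).re =
      ∫ s, (fejer N (pt (x - s)) * h s).re ∂AddCircle.haarAddCircle := by
    rw [eval_fejerMean N hi]
    simp only [← pt_sub]
    exact (integral_re (integrable_mul_bounded hc hi)).symm
  have hM0 : 0 ≤ M := (h0 0).trans (hM 0)
  have hint2 : Integrable (fun s => (fejer N (pt (x - s))).re * B + 4 / (4 * η) ^ 2 / N * M)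
      AddCircle.haarAddCircle :=
    ((integrable_of_continuous hc).re.mul_const B).add (integrable_const _)
  calc _ = _ := h2
    _ ≤ ∫ s, (fejer N (pt (x - s))).re * B + 4 / (4 * η) ^ 2 / N * M
        ∂AddCircle.haarAddCircle := by
      refine integral_mono hint hint2 fun s => ?_
      have hK := re_fejer_nonneg N (norm_pt (x - s))
      simp only [Complex.re_mul_ofReal]
      -- Near `x` the bound `B` is averaged against a kernel of mass one; far from `x` the kernel
      -- itself is small and `h ≤ M` suffices.
      rcases le_total ‖x - s‖ η with hs | hs
      · have : 0 ≤ 4 / (4 * η) ^ 2 / N * M := by positivity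
        nlinarith [mul_le_mul_of_nonneg_left (hx s hs) hK]
      · have h3 := re_fejer_le N (norm_pt (x - s)) (d := 4 * η) (by positivity)
          (by linarith [four_mul_norm_le (x - s)])
        have h4 := mul_le_mul h3 (hM s) (h0 s) (by positivity)
        nlinarith [mul_nonneg hK hB]
    _ = B + 4 / (4 * η) ^ 2 / N * M := by
      have h5 : Integrable (fun s => (fejer N (pt (x - s))).re * B) AddCircle.haarAddCircle :=
        (integrable_of_continuous hc).re.mul_const B
      rw [integral_add h5 (integrable_const _), integral_mul_const, h1]
      simp

/-! ### Truncated exponentials and the basic estimate -/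

/-- The remainder is at most twice the first omitted term, and that term is at most one because
`(R²)^(R²) ≤ (2R²)!`. -/
lemma norm_exp_sub_sum_le {x : ℂ} {R : ℕ} (hR : 1 ≤ R) (hx : ‖x‖ ≤ R) :
    ‖Complex.exp x - ∑ j ∈ Finset.range (2 * R ^ 2), x ^ j / (j.factorial : ℂ)‖ ≤ 2 := by
  have hR' : (1 : ℝ) ≤ R := by exact_mod_cast hR
  have h1 : ‖x‖ / ((2 * R ^ 2).succ : ℕ) ≤ 1 / 2 := by
    rw [div_le_iff₀ (by positivity)]
    push_cast
    nlinarith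
  refine (Complex.exp_bound' h1).trans ?_
  have h2 : (R : ℝ) ^ (2 * R ^ 2) ≤ ((2 * R ^ 2).factorial : ℝ) := by
    have h3 : R ^ (2 * R ^ 2) ≤ (2 * R ^ 2).factorial := by
      calc R ^ (2 * R ^ 2) = (R ^ 2) ^ (R ^ 2) := by rw [pow_mul]
        _ ≤ (R ^ 2 + 1) ^ (R ^ 2) := by gcongr; omega
        _ ≤ (R ^ 2).factorial * (R ^ 2 + 1) ^ (R ^ 2) :=
          Nat.le_mul_of_pos_left _ (Nat.factorial_pos _)
        _ ≤ (R ^ 2 + R ^ 2).factorial := Nat.factorial_mul_pow_le_factorial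
        _ = _ := by rw [two_mul]
    exact_mod_cast h3
  have h4 : ‖x‖ ^ (2 * R ^ 2) / ((2 * R ^ 2).factorial : ℝ) ≤ 1 := by
    rw [div_le_one (by positivity)]
    exact (pow_le_pow_left₀ (norm_nonneg _) hx _).trans h2
  linarith

/-- The composition of the exponential series, truncated after `m` terms, with `κ * q`. -/
def expPoly (m : ℕ) (κ : ℝ) (q : ℂ[X]) : ℂ[X] :=
  ∑ j ∈ Finset.range m, C ((κ : ℂ) ^ j / (j.factorial : ℂ)) * q ^ j

lemma natDegree_expPoly_le (m : ℕ) (κ : ℝ) (q : ℂ[X]) :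
    (expPoly m κ q).natDegree ≤ m * q.natDegree := by
  refine natDegree_sum_le_of_forall_le _ _ fun j hj => ?_
  refine (natDegree_C_mul_le _ _).trans (natDegree_pow_le.trans ?_)
  exact Nat.mul_le_mul_right _ (Finset.mem_range.1 hj).le

lemma eval_expPoly (m : ℕ) (κ : ℝ) (q : ℂ[X]) (z : ℂ) :
    (expPoly m κ q).eval z =
      ∑ j ∈ Finset.range m, (κ * q.eval z) ^ j / (j.factorial : ℂ) := by
  rw [expPoly, eval_finsetSum]
  refine Finset.sum_congr rfl fun j _ => ?_
  rw [eval_mul, eval_C, eval_pow, mul_pow]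
  ring

/-- The basic estimate: if `h` is bounded by `A` and almost constant at the scale `A ^ (-k)`, then
the Szegő error at degrees `≥ 2 A ^ (6 k + 5)` is controlled by the integral of `h`. -/
lemma szegoError_le_exp (ρ : Measure UnitAddCircle) [IsFiniteMeasure ρ] {h : UnitAddCircle → ℝ}
    (hm : Measurable h) {A : ℕ} (hA : 1 ≤ A) (h0 : ∀ s, 0 ≤ h s) (hM : ∀ s, h s ≤ A)
    {k : ℕ} {D : ℝ} (hD : 1 ≤ D)
    (hosc : ∀ x y : UnitAddCircle, ‖x - y‖ ≤ 1 / (2 * (A : ℝ) ^ k) → h y ≤ D * h x)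
    {n : ℕ} (hn : 2 * A ^ (6 * k + 5) ≤ n) :
    szegoError ρ n ≤ 12 * √(∫ θ, Real.exp (h θ) ∂ρ) *
      Real.exp (-((∫ s, h s ∂AddCircle.haarAddCircle) / (2 * D))) := by
  have hA' : (1 : ℝ) ≤ A := by exact_mod_cast hA
  have hA0 : (0 : ℝ) < A := by linarith
  have hD0 : 0 < D := by linarith
  -- With `η = 1 / (2 A^k)` this `N` makes the far part of the Fejér mean exactly `1`; `R = N A`
  -- bounds `|q|` on the disc.
  set N := A ^ (2 * k + 1) with hNdef
  set R := A ^ (2 * k + 2) with hRdef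
  have hN : N ≠ 0 := by positivity
  have hR : 1 ≤ R := Nat.one_le_pow _ _ hA
  have habs (s : UnitAddCircle) : |h s| ≤ A := by rw [abs_of_nonneg (h0 s)]; exact hM s
  have hi : Integrable h AddCircle.haarAddCircle :=
    Integrable.of_bound hm.aestronglyMeasurable A (Eventually.of_forall habs)
  -- The `D` cancels the oscillation factor, and the `2` allows for `|P|²` being compared with
  -- `e^h`.
  set κ : ℝ := 1 / (2 * D) with hκ
  have hκ0 : 0 < κ := by positivity
  have hκ1 : κ ≤ 1 / 2 := by
    rw [hκ]; exact one_div_le_one_div_of_le (by norm_num) (by linarith)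
  have hκD : κ * D = 1 / 2 := by rw [hκ]; field_simp
  set q := fejerMean N h with hq
  set P := expPoly (2 * R ^ 2) κ q with hP
  set I := ∫ s, h s ∂AddCircle.haarAddCircle with hI
  have hI0 : 0 ≤ I := integral_nonneg h0
  have hqn {z : ℂ} (hz : ‖z‖ ≤ 1) : ‖(κ : ℂ) * q.eval z‖ ≤ R := by
    have h1 := norm_eval_fejerMean_le N hi habs hz
    have h2 : (N : ℝ) * A = R := by rw [hNdef, hRdef]; push_cast; ring
    rw [h2] at h1
    rw [norm_mul, Complex.norm_real, Real.norm_eq_abs, abs_of_pos hκ0]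
    nlinarith [norm_nonneg (q.eval z)]
  have happrox {z : ℂ} (hz : ‖z‖ ≤ 1) : ‖Complex.exp (κ * q.eval z) - P.eval z‖ ≤ 2 := by
    rw [hP, eval_expPoly]
    exact norm_exp_sub_sum_le hR (hqn hz)
  have hdeg : P.natDegree ≤ n := by
    refine (natDegree_expPoly_le _ _ _).trans (le_trans ?_ hn)
    calc 2 * R ^ 2 * q.natDegree ≤ 2 * R ^ 2 * N := by
          gcongr; exact natDegree_fejerMean_le N h
      _ = 2 * A ^ (6 * k + 5) := by rw [hNdef, hRdef]; ring
  -- the value at the origin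
  have hq0 : q.eval 0 = (I : ℂ) := eval_zero_fejerMean hN hi
  have hP0 : P.coeff 0 =
      ((∑ j ∈ Finset.range (2 * R ^ 2), (κ * I) ^ j / (j.factorial : ℝ) : ℝ) : ℂ) := by
    rw [coeff_zero_eq_eval_zero, hP, eval_expPoly, hq0]
    push_cast; rfl
  set S := ∑ j ∈ Finset.range (2 * R ^ 2), (κ * I) ^ j / (j.factorial : ℝ) with hS
  have hS1 : 1 ≤ S := by
    have hmem : 0 ∈ Finset.range (2 * R ^ 2) := Finset.mem_range.2 (by positivity)
    have := Finset.single_le_sum (f := fun j : ℕ => (κ * I) ^ j / (j.factorial : ℝ))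
      (fun j _ => by positivity) hmem
    simpa using this
  -- The truncation error `2` is absorbed using `S ≥ 1`.
  have hS2 : Real.exp (κ * I) ≤ 3 * S := by
    have h1 := happrox (z := 0) (by simp)
    rw [hq0, ← coeff_zero_eq_eval_zero, hP0, ← Complex.ofReal_mul, ← Complex.ofReal_exp,
      ← Complex.ofReal_sub, Complex.norm_real, Real.norm_eq_abs] at h1
    linarith [le_abs_self (Real.exp (κ * I) - S)]
  -- the bound on the circle
  have hbd (x : UnitAddCircle) : ‖P.eval (pt x)‖ ^ 2 ≤ 16 * Real.exp (h x) := by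
    have hre : (q.eval (pt x)).re ≤ D * h x + 1 := by
      have h1 := re_eval_fejerMean_le hN hi h0 hM x (η := 1 / (2 * (A : ℝ) ^ k)) (by positivity)
        (mul_nonneg hD0.le (h0 x)) (fun y hy => hosc x y hy)
      have h2 : 4 / (4 * (1 / (2 * (A : ℝ) ^ k))) ^ 2 / N * A = 1 := by
        rw [hNdef]; push_cast; field_simp; ring
      rwa [h2] at h1
    have h3 : ‖Complex.exp (κ * q.eval (pt x))‖ ≤ 2 * Real.exp (h x / 2) := by
      rw [Complex.norm_exp, Complex.re_ofReal_mul]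
      calc Real.exp (κ * (q.eval (pt x)).re) ≤ Real.exp (1 / 2 + h x / 2) := by
            apply Real.exp_le_exp.2
            have := mul_le_mul_of_nonneg_left hre hκ0.le
            have e : κ * (D * h x + 1) = h x / 2 + κ := by linear_combination h x * hκD
            linarith
        _ = Real.exp (1 / 2) * Real.exp (h x / 2) := Real.exp_add _ _
        _ ≤ 2 * Real.exp (h x / 2) := by
          gcongr
          have h5 : Real.exp (1 / 2) ^ 2 = Real.exp 1 := by
            rw [← Real.exp_nat_mul]; norm_num
          nlinarith [Real.exp_one_lt_d9, Real.exp_pos (1 / 2)]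
    have h4 : ‖P.eval (pt x)‖ ≤ 4 * Real.exp (h x / 2) := by
      have h5 := happrox (norm_pt x).le
      have h6 := norm_sub_norm_le (P.eval (pt x)) (Complex.exp (κ * q.eval (pt x)))
      rw [norm_sub_rev] at h6
      have h7 : 1 ≤ Real.exp (h x / 2) := Real.one_le_exp (by linarith [h0 x])
      linarith
    calc ‖P.eval (pt x)‖ ^ 2 ≤ (4 * Real.exp (h x / 2)) ^ 2 := by gcongr
      _ = 16 * Real.exp (h x) := by
        rw [mul_pow, ← Real.exp_nat_mul]; norm_num; ring
  have hint : Integrable (fun x => 16 * Real.exp (h x)) ρ := by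
    refine (Integrable.of_bound (C := Real.exp A) hm.exp.aestronglyMeasurable
      (Eventually.of_forall fun x => ?_)).const_mul 16
    rw [Real.norm_eq_abs, Real.abs_exp]
    exact Real.exp_le_exp.2 (hM x)
  have hne : P.coeff 0 ≠ 0 := by
    rw [hP0]; exact_mod_cast (by linarith : S ≠ 0)
  refine (szegoError_le ρ P hne hdeg).trans ?_
  have hsq : √(∫ θ, ‖P.eval (pt θ)‖ ^ 2 ∂ρ) ≤ 4 * √(∫ θ, Real.exp (h θ) ∂ρ) := by
    have e : (4 : ℝ) = √16 := by
      rw [show (16 : ℝ) = 4 ^ 2 by norm_num, Real.sqrt_sq (by norm_num)]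
    rw [e, ← Real.sqrt_mul (by norm_num), ← integral_const_mul]
    exact Real.sqrt_le_sqrt (integral_mono_of_nonneg (Eventually.of_forall fun _ => by positivity)
      hint (Eventually.of_forall hbd))
  have hnorm : ‖P.coeff 0‖ = S := by
    rw [hP0, Complex.norm_real, Real.norm_eq_abs, abs_of_pos (by linarith)]
  rw [hnorm, div_le_iff₀ (by linarith)]
  have hE : Real.exp (-(I / (2 * D))) * Real.exp (κ * I) = 1 := by
    rw [← Real.exp_add, hκ, Real.exp_eq_one_iff]; ring
  have hE2 : 1 ≤ Real.exp (-(I / (2 * D))) * (3 * S) := by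
    rw [← hE]; gcongr
  have := Real.sqrt_nonneg (∫ θ, Real.exp (h θ) ∂ρ)
  calc _ ≤ _ := hsq
    _ ≤ 4 * √(∫ θ, Real.exp (h θ) ∂ρ) * (Real.exp (-(I / (2 * D))) * (3 * S)) :=
      le_mul_of_one_le_right (by positivity) hE2
    _ = _ := by ring

/-! ### Doubling and the oscillation of truncations -/

/-- Under `Reg1`, monotonicity of `θ φ(θ)` between `θ/2` and `θ` gives the constant `2`. -/
lemma Regular.exists_doubling {φ : ℝ → ℝ≥0∞} (hφ : Regular φ) :
    ∃ D : ℝ≥0, 1 ≤ D ∧ ∀ θ ∈ Ioc (0 : ℝ) (1 / 2), φ (θ / 2) ≤ D * φ θ := by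
  rcases hφ with ⟨hmono, -⟩ | ⟨⟨C, hC⟩, -⟩
  · refine ⟨2, by norm_num, fun θ hθ => ?_⟩
    have h1 := hmono (a := θ / 2) ⟨by linarith [hθ.1], by linarith [hθ.1, hθ.2]⟩ hθ
      (by linarith [hθ.1])
    simp only at h1
    have hpos : 0 < θ / 2 := by linarith [hθ.1]
    have h2 : ENNReal.ofReal θ = ENNReal.ofReal (θ / 2) * 2 := by
      rw [show (2 : ℝ≥0∞) = ENNReal.ofReal 2 by simp, ← ENNReal.ofReal_mul hpos.le]
      congr 1; ring
    rw [h2, mul_assoc] at h1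
    exact (ENNReal.mul_le_mul_iff_right (by simpa using hpos) ENNReal.ofReal_ne_top).1 h1
  · refine ⟨max C 1, le_max_right _ _, fun θ hθ => (hC θ hθ).trans ?_⟩
    gcongr
    exact le_max_left _ _

/-- A majorant growing at least like a power at the origin exceeds `A` only on a set of at least
power size. -/
lemma IsMajorant.exists_pow_le {φ : ℝ → ℝ≥0∞} (hφ : IsMajorant φ)
    (hlog : ∃ c : ℝ, 0 < c ∧ ∀ᶠ θ : ℝ in 𝓝[>] 0,
      c * Real.log (1 / θ) ≤ Real.log (φ θ).toReal) :
    ∃ k A₀ : ℕ, 2 ≤ A₀ ∧ ∀ A : ℕ, A₀ ≤ A → ∀ s ∈ Icc (0 : ℝ) (1 / 2), φ s ≤ A →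
      1 / (A : ℝ) ^ k ≤ s := by
  obtain ⟨c, hc, hev⟩ := hlog
  obtain ⟨ε, hε, hεs⟩ := mem_nhdsGT_iff_exists_Ioo_subset.1 hev
  obtain ⟨k, hk⟩ := exists_nat_gt (1 / c)
  have hε0 : (0 : ℝ) < ε := hε
  obtain ⟨B, hB⟩ := exists_nat_gt (1 / ε)
  have hk0 : (0 : ℝ) < k := (by positivity : (0 : ℝ) < 1 / c).trans hk
  have hkn : k ≠ 0 := by rintro rfl; simp at hk0
  refine ⟨k, max B 2, le_max_right _ _, fun A hA s hs hφs => ?_⟩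
  by_contra! hlt
  have hA2 : (2 : ℝ) ≤ A := by exact_mod_cast (le_max_right B 2).trans hA
  have hAB : (B : ℝ) ≤ A := by exact_mod_cast (le_max_left B 2).trans hA
  have hs0 : 0 < s := by
    rcases hs.1.eq_or_lt with h | h
    · rw [← h, hφ.map_zero] at hφs
      exact absurd (top_le_iff.1 hφs) (ENNReal.natCast_ne_top A)
    · exact h
  have hsA : (A : ℝ) ^ k < 1 / s := by
    rw [lt_div_iff₀ hs0]; rwa [lt_div_iff₀ (by positivity), mul_comm] at hlt
  have hsε : s < ε := by
    have h1 : (A : ℝ) ≤ (A : ℝ) ^ k := le_self_pow₀ (by linarith) hkn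
    have h2 : 1 / ε < 1 / s := by linarith
    exact (one_div_lt_one_div hε0 hs0).1 h2
  have h3 : c * Real.log (1 / s) ≤ Real.log (φ s).toReal := hεs ⟨hs0, hsε⟩
  have h4 : (k : ℝ) * Real.log A < Real.log (1 / s) := by
    rw [← Real.log_pow]; exact Real.log_lt_log (by positivity) hsA
  have hlA : 0 < Real.log A := Real.log_pos (by linarith)
  have h5 : Real.log (φ s).toReal ≤ Real.log A := by
    apply Real.log_le_log
    · exact ENNReal.toReal_pos (hφ.pos s hs).ne'
        (ne_top_of_le_ne_top (ENNReal.natCast_ne_top A) hφs)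
    · simpa using ENNReal.toReal_mono (ENNReal.natCast_ne_top A) hφs
  have h6 : 1 < c * k := by rwa [div_lt_iff₀ hc, mul_comm] at hk
  nlinarith [mul_lt_mul_of_pos_left h4 hc, mul_lt_mul_of_pos_right h6 hlA]

/-- The truncation `min (H, A)`, as a real function. -/
def trunc (H : UnitAddCircle → ℝ≥0∞) (A : ℕ) (x : UnitAddCircle) : ℝ := (min (H x) A).toReal

lemma trunc_nonneg (H : UnitAddCircle → ℝ≥0∞) (A : ℕ) (x : UnitAddCircle) : 0 ≤ trunc H A x :=
  ENNReal.toReal_nonneg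

lemma trunc_le (H : UnitAddCircle → ℝ≥0∞) (A : ℕ) (x : UnitAddCircle) : trunc H A x ≤ A := by
  simpa [trunc] using ENNReal.toReal_mono (ENNReal.natCast_ne_top A) (min_le_right (H x) A)

lemma measurable_trunc {H : UnitAddCircle → ℝ≥0∞} (hH : Measurable H) (A : ℕ) :
    Measurable (trunc H A) :=
  (hH.min measurable_const).ennreal_toReal

lemma ofReal_trunc (H : UnitAddCircle → ℝ≥0∞) (A : ℕ) (x : UnitAddCircle) :
    ENNReal.ofReal (trunc H A x) = min (H x) A :=
  ENNReal.ofReal_toReal (ne_top_of_le_ne_top (ENNReal.natCast_ne_top A) (min_le_right _ _))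

/-- Only `τ` is confined to the fundamental interval; `θ` may leave it, as subordination permits. -/
lemma exists_lift (x y : UnitAddCircle) :
    ∃ τ ∈ Icc (-(1 / 2) : ℝ) (1 / 2), ∃ θ : ℝ, (τ : UnitAddCircle) = x ∧
      (θ : UnitAddCircle) = y ∧ |τ - θ| = ‖x - y‖ := by
  obtain ⟨τ, h1, h2, -⟩ := exists_abs_eq_norm x
  obtain ⟨d, -, h3, h4⟩ := exists_abs_eq_norm (x - y)
  refine ⟨τ, abs_le.1 h1, τ - d, h2, ?_, ?_⟩
  · rw [AddCircle.coe_sub, h2, h3]; abel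
  · rw [sub_sub_cancel, h4]

/-- If `H x ≤ A`, solve `φ(s) = H x`. Then `s ≥ η`, so `y` lies within `s/2` of `x`, and
subordination and doubling give `H y ≤ φ(s/2) ≤ D φ(s)`. If `H x ≥ A`, the truncation at `x` is
already maximal. -/
lemma Subordinated.trunc_le_mul {H : UnitAddCircle → ℝ≥0∞} {φ : ℝ → ℝ≥0∞}
    (hsub : Subordinated H φ) {D : ℝ≥0} (hD : 1 ≤ D)
    (hdbl : ∀ θ ∈ Ioc (0 : ℝ) (1 / 2), φ (θ / 2) ≤ D * φ θ) {A : ℕ} {η : ℝ}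
    (hη : ∀ s ∈ Icc (0 : ℝ) (1 / 2), φ s ≤ A → η ≤ s) (hη0 : 0 < η) {x y : UnitAddCircle}
    (hxy : ‖x - y‖ ≤ η / 2) : trunc H A y ≤ D * trunc H A x := by
  have hD' : (1 : ℝ) ≤ D := by exact_mod_cast hD
  rcases le_total (H x) A with hx | hx
  · obtain ⟨τ, hτ, θ, rfl, rfl, hd⟩ := exists_lift x y
    have hmem : H (τ : UnitAddCircle) ∈ Icc (φ (1 / 2)) (φ 0) :=
      ⟨hsub.le_inf.trans (iInf_le _ _), by rw [hsub.majorant.map_zero]; exact le_top⟩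
    obtain ⟨s, hs, hφs⟩ :=
      intermediate_value_Icc' (by norm_num) hsub.majorant.continuousOn hmem
    have hηs : η ≤ s := hη s hs (hφs ▸ hx)
    have hs0 : 0 < s := hη0.trans_le hηs
    have hdist : |τ - θ| ≤ s / 2 := by rw [hd]; linarith
    have hanti {u : ℝ} (h1 : s / 2 ≤ u) (h2 : u ≤ s) : φ u ≤ D * H (τ : UnitAddCircle) := by
      refine le_trans ?_ (hφs ▸ hdbl s ⟨hs0, hs.2⟩)
      exact hsub.majorant.strictAntiOn.antitoneOn ⟨by linarith, by linarith [hs.2]⟩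
        ⟨by linarith, by linarith [hs.2]⟩ h1
    have hHy : H (θ : UnitAddCircle) ≤ D * H (τ : UnitAddCircle) := by
      obtain ⟨h1, h2⟩ := abs_le.1 hdist
      rcases le_total θ τ with h | h
      · exact (hsub.left τ hτ s hs hφs θ (by linarith) h).trans
          (hanti (by linarith) (by linarith))
      · exact (hsub.right τ hτ s hs hφs θ h (by linarith)).trans
          (hanti (by linarith) (by linarith))
    have hne : H (τ : UnitAddCircle) ≠ ∞ := ne_top_of_le_ne_top (ENNReal.natCast_ne_top A) hx
    rw [trunc, trunc, min_eq_left hx]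
    have := ENNReal.toReal_mono (ENNReal.mul_ne_top ENNReal.coe_ne_top hne)
      ((min_le_left _ (A : ℝ≥0∞)).trans hHy)
    simpa using this
  · have h1 : trunc H A x = A := by rw [trunc, min_eq_right hx]; simp
    rw [h1]
    nlinarith [trunc_le H A y, (Nat.cast_nonneg A : (0 : ℝ) ≤ A)]

/-! ### Growth of the truncated integrals -/

/-- Layer-cake lower bound: if `a λ_H(a) ≥ D` for `a ≥ a₁` then the integral of `min (H, A)` grows
at least like `D log A`. -/
lemma mul_log_le_integral_trunc {H : UnitAddCircle → ℝ≥0∞} (hH : Measurable H) {D a₁ : ℝ}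
    (hD : 0 < D) (ha₁ : 0 < a₁)
    (hdist : ∀ a, a₁ ≤ a → ENNReal.ofReal D ≤ ENNReal.ofReal a * distribution H a) {A : ℕ}
    (hA : a₁ ≤ A) :
    D * Real.log (A / a₁) ≤ ∫ s, trunc H A s ∂AddCircle.haarAddCircle := by
  have hi : Integrable (trunc H A) AddCircle.haarAddCircle :=
    Integrable.of_bound (measurable_trunc hH A).aestronglyMeasurable A
      (Eventually.of_forall fun s => by
        rw [Real.norm_eq_abs, abs_of_nonneg (trunc_nonneg H A s)]; exact trunc_le H A s)
  have hi0 : 0 ≤ ∫ s, trunc H A s ∂AddCircle.haarAddCircle := integral_nonneg (trunc_nonneg H A)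
  rw [← ENNReal.ofReal_le_ofReal_iff hi0,
    ofReal_integral_eq_lintegral_ofReal hi (Eventually.of_forall (trunc_nonneg H A)),
    lintegral_eq_lintegral_meas_lt _ (Eventually.of_forall (trunc_nonneg H A)) hi.aemeasurable]
  have hint : IntervalIntegrable (fun t : ℝ => t⁻¹) volume a₁ A :=
    intervalIntegral.intervalIntegrable_inv
      (fun t ht => by rw [uIcc_of_le hA] at ht; exact (ha₁.trans_le ht.1).ne') continuousOn_id
  have h1 : D * Real.log (A / a₁) = ∫ t in Ioo a₁ A, D * t⁻¹ := by
    rw [← integral_Ioc_eq_integral_Ioo, ← intervalIntegral.integral_of_le hA,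
      intervalIntegral.integral_const_mul, integral_inv_of_pos ha₁ (ha₁.trans_le hA)]
  have hio : IntegrableOn (fun t : ℝ => D * t⁻¹) (Ioo a₁ A) :=
    (((intervalIntegrable_iff_integrableOn_Ioc_of_le hA).1 hint).mono_set
      Ioo_subset_Ioc_self).const_mul D
  rw [h1, ofReal_integral_eq_lintegral_ofReal hio
    ((ae_restrict_mem measurableSet_Ioo).mono fun t ht => by
      have := ha₁.trans ht.1
      positivity)]
  refine le_trans (setLIntegral_mono' measurableSet_Ioo fun t ht => ?_)
    (lintegral_mono_set fun t ht => ha₁.trans ht.1)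
  have ht0 : 0 < t := ha₁.trans ht.1
  -- Below the level `A`, truncation does not change superlevel sets.
  have hset : {s | t < trunc H A s} = {s | ENNReal.ofReal t < H s} := by
    ext s
    have h2 : ENNReal.ofReal t < A := by
      rw [← ENNReal.ofReal_natCast A]
      exact (ENNReal.ofReal_lt_ofReal_iff (ht0.trans ht.2)).2 ht.2
    rw [mem_ofPred_eq, mem_ofPred_eq, ← ENNReal.ofReal_lt_ofReal_iff_of_nonneg ht0.le, ofReal_trunc,
      lt_min_iff]
    exact and_iff_left h2
  rw [hset, ENNReal.ofReal_mul hD.le, ENNReal.ofReal_inv_of_pos ht0, ← div_eq_mul_inv]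
  exact ENNReal.div_le_of_le_mul' (hdist t ht.1.le)

lemma integral_exp_trunc_le {ρ : Measure UnitAddCircle} {H : UnitAddCircle → ℝ≥0∞}
    (hH : Measurable H) (hρ : ∫⁻ t, EReal.exp (H t : EReal) ∂ρ < ∞) (A : ℕ) :
    ∫ t, Real.exp (trunc H A t) ∂ρ ≤ (∫⁻ t, EReal.exp (H t : EReal) ∂ρ).toReal := by
  rw [integral_eq_lintegral_of_nonneg_ae (Eventually.of_forall fun t => (Real.exp_pos _).le)
    (measurable_trunc hH A).exp.aestronglyMeasurable]
  refine ENNReal.toReal_mono hρ.ne (lintegral_mono fun t => ?_)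
  rw [← EReal.exp_coe]
  refine EReal.exp_monotone ?_
  have h : ((trunc H A t : ℝ) : EReal) = ((min (H t) A : ℝ≥0∞) : EReal) := by
    rw [← ofReal_trunc, EReal.coe_ennreal_ofReal, max_eq_left (trunc_nonneg H A t)]
  rw [h]
  exact EReal.coe_ennreal_le_coe_ennreal_iff.2 (min_le_left _ _)

/-! ### From truncation levels to powers of the degree -/

/-- If `J ≥ 1` and a sequence is `O(A ^ (-r))` uniformly over `n ≥ A ^ J`, then it is
`O(n ^ (-r / J))`. -/
lemma isBigO_rpow_of_le {e : ℕ → ℝ} (he : ∀ n, 0 ≤ e n) {J A₀ : ℕ} (hJ : 1 ≤ J) {B r : ℝ}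
    (hr : 0 < r)
    (h : ∀ A : ℕ, A₀ ≤ A → ∀ n : ℕ, A ^ J ≤ n → e n ≤ B * (A : ℝ) ^ (-r)) :
    e =O[atTop] fun n : ℕ => (n : ℝ) ^ (-(r / J)) := by
  have hJ0 : (0 : ℝ) < J := by exact_mod_cast hJ
  refine Asymptotics.IsBigO.of_bound (|B| * 2 ^ r) ?_
  have hev : ∀ᶠ n : ℕ in atTop, (A₀ : ℝ) + 2 ≤ (n : ℝ) ^ (1 / (J : ℝ)) :=
    ((tendsto_rpow_atTop (by positivity)).comp tendsto_natCast_atTop_atTop).eventually_ge_atTop _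
  filter_upwards [hev] with n hn
  -- The level is `A = ⌊n^(1/J)⌋`; the floor loses at most a factor `2`, hence the constant `2 ^ r`.
  set x := (n : ℝ) ^ (1 / (J : ℝ)) with hx
  have hx0 : 0 < x := by have := (Nat.cast_nonneg A₀ : (0 : ℝ) ≤ A₀); linarith
  have hxJ : x ^ J = n := by
    rw [hx, one_div]; exact Real.rpow_inv_natCast_pow (Nat.cast_nonneg n) (by omega)
  have hfl : (⌊x⌋₊ : ℝ) ≤ x := Nat.floor_le hx0.le
  have hfl2 : x / 2 ≤ ⌊x⌋₊ := by
    have := Nat.lt_floor_add_one x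
    have := (Nat.cast_nonneg A₀ : (0 : ℝ) ≤ A₀)
    linarith
  have h1 := h ⌊x⌋₊ (Nat.le_floor (by linarith)) n (by
    have : (⌊x⌋₊ : ℝ) ^ J ≤ n := by rw [← hxJ]; gcongr
    exact_mod_cast this)
  have h2 : (n : ℝ) ^ (-(r / J)) = x ^ (-r) := by
    rw [hx, ← Real.rpow_mul (Nat.cast_nonneg n)]; congr 1; ring
  have h3 : (⌊x⌋₊ : ℝ) ^ (-r) ≤ 2 ^ r * x ^ (-r) := by
    calc (⌊x⌋₊ : ℝ) ^ (-r) ≤ (x / 2) ^ (-r) :=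
          Real.rpow_le_rpow_of_nonpos (by positivity) hfl2 (by linarith)
      _ = 2 ^ r * x ^ (-r) := by
        rw [Real.div_rpow hx0.le (by norm_num), Real.rpow_neg (by norm_num : (0 : ℝ) ≤ 2),
          div_inv_eq_mul, mul_comm]
  rw [h2, Real.norm_eq_abs, Real.norm_eq_abs, abs_of_nonneg (he n),
    abs_of_nonneg (Real.rpow_nonneg hx0.le _)]
  calc e n ≤ B * (⌊x⌋₊ : ℝ) ^ (-r) := h1
    _ ≤ |B| * (2 ^ r * x ^ (-r)) := by
      refine mul_le_mul (le_abs_self B) h3 (by positivity) (abs_nonneg B)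
    _ = _ := by ring

lemma szegoError_nonneg (ρ : Measure UnitAddCircle) (n : ℕ) : 0 ≤ szegoError ρ n :=
  Real.iInf_nonneg fun _ => Real.sqrt_nonneg _

/-- Quantitative form of the theorem: the exponent in the bound for the Szegő error is a fixed
multiple of the lower bound `D` for `a λ_H(a)`. -/
lemma exists_exponent (ρ : Measure UnitAddCircle) [IsFiniteMeasure ρ]
    {H : UnitAddCircle → ℝ≥0∞} (hH : Measurable H)
    (hρ : ∫⁻ t, EReal.exp (H t : EReal) ∂ρ < ∞)
    {φ : ℝ → ℝ≥0∞} (hsub : Subordinated H φ) (hreg : Regular φ)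
    (hlog : ∃ c : ℝ, 0 < c ∧ ∀ᶠ θ : ℝ in 𝓝[>] 0,
      c * Real.log (1 / θ) ≤ Real.log (φ θ).toReal) :
    ∃ σ : ℝ, 0 < σ ∧ ∀ D : ℝ, 0 < D →
      (∀ᶠ a : ℝ in atTop, ENNReal.ofReal D ≤ ENNReal.ofReal a * distribution H a) →
      szegoError ρ =O[atTop] fun n : ℕ => (n : ℝ) ^ (-(σ * D)) := by
  obtain ⟨C, hC, hdbl⟩ := hreg.exists_doubling
  obtain ⟨k, A₀, hA₀, hk⟩ := hsub.majorant.exists_pow_le hlog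
  have hC' : (1 : ℝ) ≤ C := by exact_mod_cast hC
  -- The basic estimate decays like `A^(-D/(2C))` for `n ≥ A^(6k+6)`. Raising the degree exponent
  -- from `6k+5` absorbs the factor `2`, since `A ≥ 2`.
  refine ⟨1 / (2 * C) / ((6 * k + 6 : ℕ) : ℝ), by positivity, fun D hD hev => ?_⟩
  obtain ⟨a₀, ha₀⟩ := eventually_atTop.1 hev
  set a₁ := max a₀ 1 with ha₁
  have ha₁0 : 0 < a₁ := lt_max_of_lt_right one_pos
  set r := D / (2 * C) with hr
  have hr0 : 0 < r := by positivity
  set E := (∫⁻ t, EReal.exp (H t : EReal) ∂ρ).toReal with hE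
  have hexp : 1 / (2 * (C : ℝ)) / ((6 * k + 6 : ℕ) : ℝ) * D = r / ((6 * k + 6 : ℕ) : ℝ) := by
    rw [hr]; ring
  rw [hexp]
  refine isBigO_rpow_of_le (szegoError_nonneg ρ) (J := 6 * k + 6) (A₀ := max A₀ ⌈a₁⌉₊)
    (B := 12 * √E * a₁ ^ r) (by omega) hr0 fun A hA n hn => ?_
  have hA1 : A₀ ≤ A := (le_max_left _ _).trans hA
  have hA2 : a₁ ≤ A := (Nat.le_ceil a₁).trans (by exact_mod_cast (le_max_right _ _).trans hA)
  have hA0 : (0 : ℝ) < A := ha₁0.trans_le hA2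
  have hdeg : 2 * A ^ (6 * k + 5) ≤ n := by
    refine le_trans ?_ hn
    rw [pow_succ A (6 * k + 5), mul_comm]
    exact Nat.mul_le_mul_left _ (hA₀.trans hA1)
  have h1 := szegoError_le_exp ρ (measurable_trunc hH A) (by omega) (trunc_nonneg H A)
    (trunc_le H A) hC' (k := k) (fun x y hxy =>
      hsub.trunc_le_mul hC hdbl (hk A hA1) (by positivity) (hxy.trans_eq (by ring))) hdeg
  have h2 := mul_log_le_integral_trunc hH hD ha₁0
    (fun a ha => ha₀ a ((le_max_left _ _).trans ha)) hA2
  have h3 : Real.exp (-((∫ s, trunc H A s ∂AddCircle.haarAddCircle) / (2 * C))) ≤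
      a₁ ^ r * (A : ℝ) ^ (-r) := by
    have h4 : a₁ ^ r * (A : ℝ) ^ (-r) = Real.exp (-(D * Real.log (A / a₁) / (2 * C))) := by
      rw [Real.rpow_def_of_pos ha₁0, Real.rpow_def_of_pos hA0, ← Real.exp_add,
        Real.log_div hA0.ne' ha₁0.ne', hr]
      congr 1; ring
    rw [h4]
    gcongr
  calc szegoError ρ n ≤ _ := h1
    _ ≤ 12 * √E * (a₁ ^ r * (A : ℝ) ^ (-r)) := by
      gcongr
      exact integral_exp_trunc_le hH hρ A
    _ = _ := by ring

end SzegoMin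

end

theorem mainTheorem9 (ρ : Measure UnitAddCircle) [IsFiniteMeasure ρ]
    (H : UnitAddCircle → ℝ≥0∞) (hH : Measurable H)
    (hHint : ∫⁻ t, H t ∂AddCircle.haarAddCircle = ∞)
    (hρ : ∫⁻ t, EReal.exp (H t : EReal) ∂ρ < ∞)
    (φ : ℝ → ℝ≥0∞) (hsub : SzegoMin.Subordinated H φ) (hreg : SzegoMin.Regular φ)
    (hlog : ∃ c : ℝ, 0 < c ∧ ∀ᶠ θ : ℝ in 𝓝[>] 0,
      c * Real.log (1 / θ) ≤ Real.log (φ θ).toReal) :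
    (0 < liminf (fun a : ℝ => ENNReal.ofReal a * SzegoMin.distribution H a) atTop →
      ∃ p : ℝ, 0 < p ∧ SzegoMin.szegoError ρ =O[atTop] fun n : ℕ => (n : ℝ) ^ (-p)) ∧
    (Tendsto (fun a : ℝ => ENNReal.ofReal a * SzegoMin.distribution H a) atTop (𝓝 ∞) →
      ∀ p : ℝ, 0 < p → SzegoMin.szegoError ρ =o[atTop] fun n : ℕ => (n : ℝ) ^ (-p)) := by
  obtain ⟨σ, hσ, key⟩ := SzegoMin.exists_exponent ρ hH hρ hsub hreg hlog
  refine ⟨fun hlim => ?_, fun hlim p hp => ?_⟩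
  · obtain ⟨D, hD0, hD⟩ := ENNReal.lt_iff_exists_nnreal_btwn.1 hlim
    have hD0' : (0 : ℝ) < D := by exact_mod_cast hD0
    refine ⟨σ * D, by positivity, key D hD0' ?_⟩
    filter_upwards [eventually_lt_of_lt_liminf hD] with a ha
    rw [ENNReal.ofReal_coe_nnreal]
    exact ha.le
  -- This `D` yields `O(n^(-(p+1)))`, one power more than required.
  · have h1 := key ((p + 1) / σ) (by positivity)
      (hlim.eventually (eventually_ge_nhds ENNReal.ofReal_lt_top))
    rw [mul_div_cancel₀ _ hσ.ne'] at h1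
    refine h1.trans_isLittleO ?_
    refine (Asymptotics.isLittleO_iff_tendsto' ?_).2 ?_
    · filter_upwards [eventually_gt_atTop 0] with n hn h
      have : (0 : ℝ) < n := by exact_mod_cast hn
      exact absurd h (by positivity)
    · refine (tendsto_inv_atTop_nhds_zero_nat (𝕜 := ℝ)).congr' ?_
      filter_upwards [eventually_gt_atTop 0] with n hn
      have : (0 : ℝ) < n := by exact_mod_cast hn
      rw [← Real.rpow_sub this, ← Real.rpow_neg_one]
      congr 1; ring
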